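/- Let $P$ be an algebraically closed field, $n\ge 0$ an integer and $P[X]=P[x_1,\dots,x_n]$ the polynomial algebra. Let $\mathrm{End}(P[X])$ be the semigroup of $P$-algebra endomorphisms of $P[X]$ under composition, and let $\mathrm{Aut}(\mathrm{End}(P[X]))$ be the group of automorphisms of this semigroup. Call $\tau\in\mathrm{Aut}(\mathrm{End}(P[X]))$ semi-inner if there are a field automorphism $\alpha$ of $P$ and a $P$-algebra automorphism $\eta$ of $P[X]$ such that, for the bijection $\mu=\overline{\alpha}\circ\eta$ of $P[X]$, where $\overline{\alpha}(\sum_k a_k u_k)=\sum_k\alpha(a_k)u_k$ ($a_k\in P$, $u_k$ monomials), one has $\tau(s)=\mu\circ s\circ\mu^{-1}$ for every $s\in\mathrm{End}(P[X])$. Then the group $\mathrm{Aut}(\mathrm{End}(P[X]))$ is generated by semi-inner automorphisms; moreover, every automorphism of the semigroup $\mathrm{End}(P[X])$ is semi-inner. -/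

import Mathlib

/-- The semigroup `End(P[x₁, …, xₙ])` of `P`-algebra endomorphisms, with composition as product. -/
abbrev EndPoly (P : Type*) [Field P] (n : ℕ) : Type _ :=
  MvPolynomial (Fin n) P →ₐ[P] MvPolynomial (Fin n) P

/-- The coefficientwise extension `∑ aₖ uₖ ↦ ∑ α(aₖ) uₖ` (with `uₖ` monomials) of a field
automorphism `α` of `P`, as a bijection of `P[x₁, …, xₙ]`. -/
noncomputable def coeffExtension {P : Type*} [Field P] (n : ℕ) (α : P ≃+* P) :
    Equiv.Perm (MvPolynomial (Fin n) P) :=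
  (MvPolynomial.mapEquiv (Fin n) α).toEquiv

/-- The bijection `μ` of `P[x₁, …, xₙ]` generates the automorphism `τ` of the semigroup
`End(P[x₁, …, xₙ])`: `τ(s) = μ s μ⁻¹` as maps, for every endomorphism `s`. -/
def Generates {P : Type*} [Field P] {n : ℕ} (μ : Equiv.Perm (MvPolynomial (Fin n) P))
    (τ : MulAut (EndPoly P n)) : Prop :=
  ∀ s : EndPoly P n, ⇑(τ s) = ⇑μ ∘ ⇑s ∘ ⇑μ.symm

/-- `τ` is semi-inner: it is generated by a bijection `μ = αη` (first `η`, then `α`), where `α` is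
the coefficientwise extension of a field automorphism of `P` and `η` is a `P`-algebra automorphism
of `P[x₁, …, xₙ]`. -/
def IsSemiInner {P : Type*} [Field P] {n : ℕ} (τ : MulAut (EndPoly P n)) : Prop :=
  ∃ (α : P ≃+* P) (η : MvPolynomial (Fin n) P ≃ₐ[P] MvPolynomial (Fin n) P),
    Generates (coeffExtension n α * η.toEquiv) τ

/-! Evaluations at points are right zeros of the semigroup, so `τ` induces a bijection `φ` of `Pⁿ`
(`pointMap`) that conjugates the polynomial self-maps of `Pⁿ` among themselves. The task is to show
that `φ` is polynomial up to a field automorphism. The image under `φ` of a coordinate axis is the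
image of an idempotent polynomial map, dual to a retraction `r`. Restriction to a line composed with
that map embeds the fixed ring of `r` in `P[t]`; as a retract of a factorial ring it is then `P[f]`
(`exists_generator_of_retract`). Hence `f` is a polynomial coordinate on the image axis, and the
induced bijection `ψ` of `P` conjugates polynomials to polynomials, so it is affine after a field
automorphism `α`. Routing an arbitrary polynomial function through the axis yields `η`. -/

/-! ### Bijections of a field preserving polynomial functions -/

open Polynomial in
/-- A bijection of an infinite field which conjugates polynomial functions to polynomial functions is
a field automorphism followed by an affine map. -/
theorem exists_ringEquiv_affine_of_conj_polynomial {K : Type*} [Field K] [Infinite K]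
    (ψ : K → K) (hψ : Function.Bijective ψ)
    (h : ∀ p : K[X], ∃ q : K[X], ∀ x, ψ (p.eval x) = q.eval (ψ x)) :
    ∃ (α : K ≃+* K) (a b : K), a ≠ 0 ∧ ∀ x, ψ x = a * α x + b := by
  have affine : ∀ u v : K, u ≠ 0 → ∃ u' v' : K, ∀ x, ψ (u * x + v) = u' * ψ x + v' := by
    intro u v hu
    obtain ⟨q, hq⟩ := h (C u * X + C v)
    obtain ⟨q', hq'⟩ := h (C u⁻¹ * X + C (-(u⁻¹ * v)))
    -- The inverse affine map is conjugated to a polynomial too, and degrees multiply under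
    -- composition.
    have hcomp : q.comp q' = X := by
      refine Polynomial.funext fun y => ?_
      obtain ⟨x, rfl⟩ := hψ.2 y
      rw [eval_comp, ← hq', ← hq, eval_X]
      congr 1
      simp only [eval_add, eval_mul, eval_C, eval_X]
      field_simp
      ring
    have hdeg : q.natDegree = 1 := by
      have := congrArg natDegree hcomp
      rw [natDegree_comp, natDegree_X] at this
      exact Nat.eq_one_of_mul_eq_one_right this
    obtain ⟨u', _, v', rfl⟩ := Polynomial.natDegree_eq_one.mp hdeg
    exact ⟨u', v', fun x => by simpa using hq x⟩
  have add : ∀ x b, ψ (x + b) - ψ 0 = (ψ x - ψ 0) + (ψ b - ψ 0) := by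
    intro x b
    by_cases hb : b = 0
    · simp [hb]
    obtain ⟨u', v', hu⟩ := affine 1 b one_ne_zero
    simp only [one_mul] at hu
    -- A map of slope other than 1 has a fixed point; a nonzero translation has none.
    have hu' : u' = 1 := by
      by_contra hne
      have h1 : 1 - u' ≠ 0 := sub_ne_zero.mpr (Ne.symm hne)
      obtain ⟨z, hz⟩ := hψ.2 (v' / (1 - u'))
      have : ψ (z + b) = ψ z := by
        rw [hu, hz]
        field_simp
        ring
      exact hb (by simpa using hψ.1 this)
    subst hu'
    have h0 := hu 0
    rw [zero_add] at h0
    rw [hu, h0]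
    ring
  have h10 : ψ 1 - ψ 0 ≠ 0 := fun h => one_ne_zero (hψ.1 (sub_eq_zero.mp h))
  have mul : ∀ u x, (ψ (u * x) - ψ 0) * (ψ 1 - ψ 0) = (ψ u - ψ 0) * (ψ x - ψ 0) := by
    intro u x
    by_cases hu : u = 0
    · simp [hu]
    obtain ⟨u', v', hu⟩ := affine u 0 hu
    simp only [add_zero] at hu
    have h0 := hu 0
    have h1 := hu 1
    rw [mul_zero] at h0
    rw [mul_one] at h1
    rw [hu, h1]
    linear_combination (ψ x - ψ 1) * h0
  let α : K →+* K :=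
    { toFun := fun x => (ψ x - ψ 0) / (ψ 1 - ψ 0)
      map_one' := div_self h10
      map_zero' := by simp
      map_add' := fun x y => by rw [add, add_div]
      map_mul' := fun x y => by
        have := mul x y
        field_simp
        exact this }
  have hα : ∀ x, ψ x = (ψ 1 - ψ 0) * α x + ψ 0 := fun x => by
    change ψ x = (ψ 1 - ψ 0) * ((ψ x - ψ 0) / (ψ 1 - ψ 0)) + ψ 0
    field_simp
    ring
  have hbij : Function.Bijective α := by
    refine ⟨α.injective, fun y => ?_⟩
    obtain ⟨x, hx⟩ := hψ.2 ((ψ 1 - ψ 0) * y + ψ 0)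
    refine ⟨x, mul_left_cancel₀ h10 ?_⟩
    rw [hα x] at hx
    exact add_right_cancel hx
  exact ⟨RingEquiv.ofBijective α hbij, _, _, h10, hα⟩

open Polynomial in
/-- Every polynomial is integral over the subalgebra generated by a nonconstant polynomial. -/
theorem isIntegralElem_aeval_of_natDegree_pos {K : Type*} [Field K] (f : K[X])
    (hf : 0 < f.natDegree) (h : K[X]) :
    (aeval f : K[X] →ₐ[K] K[X]).toRingHom.IsIntegralElem h := by
  have hC : ∀ a : K, (aeval f : K[X] →ₐ[K] K[X]).toRingHom.IsIntegralElem (C a) := fun a => by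
    have := RingHom.isIntegralElem_map (aeval f : K[X] →ₐ[K] K[X]).toRingHom (x := C a)
    simpa using this
  have hX : (aeval f : K[X] →ₐ[K] K[X]).toRingHom.IsIntegralElem X := by
    have hlc : f.leadingCoeff ≠ 0 := by
      rw [Ne, leadingCoeff_eq_zero]
      rintro rfl
      simp at hf
    have hm : (f * C f.leadingCoeff⁻¹).Monic := monic_mul_leadingCoeff_inv (by
      rintro rfl
      simp at hf)
    -- With `Y` standing for `f`, `X` is a root of `(f(T) - Y) / lc(f)`, monic in `T`.
    refine ⟨(f * C f.leadingCoeff⁻¹).map C - C (X * C f.leadingCoeff⁻¹), ?_, ?_⟩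
    · refine (hm.map C).sub_of_left ?_
      refine lt_of_le_of_lt degree_C_le ?_
      rw [degree_map_eq_of_injective C_injective, degree_mul_C (inv_ne_zero hlc)]
      exact natDegree_pos_iff_degree_pos.mp hf
    · have : ((aeval f : K[X] →ₐ[K] K[X]).toRingHom.comp C) = C := by
        ext a
        simp
      rw [eval₂_sub, eval₂_map, this, eval₂_C]
      simp [eval₂_C_X, mul_comm f]
  induction h using Polynomial.induction_on with
  | C a => exact hC a
  | add p q hp hq => exact hp.add _ hq
  | monomial n a ih =>
    rw [pow_succ, ← mul_assoc]
    exact ih.mul _ hX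

/-! ### Retracts of factorial rings inside `K[X]` -/

section Retract

open Polynomial

variable {K R : Type*} [Field K] [CommRing R] [Algebra K R] (r : R →ₐ[K] R) (g : R →ₐ[K] K[X])

/-- If a retract of a factorial domain embeds into `K[X]`, its elements of degree zero are the
constants. -/
theorem eq_algebraMap_of_natDegree_eq_zero {h : R}
    (hg : ∀ x, r x = x → g x = 0 → x = 0) (hh : r h = h) (hd : (g h).natDegree = 0) :
    ∃ c : K, h = algebraMap K R c := by
  refine ⟨(g h).coeff 0, sub_eq_zero.mp (hg _ (by simp [hh]) ?_)⟩
  rw [map_sub, AlgHom.commutes, sub_eq_zero]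
  exact eq_C_of_natDegree_eq_zero hd

theorem exists_prime_dvd_of_natDegree_pos [UniqueFactorizationMonoid R] (x : R)
    (hx : 0 < (g (r x)).natDegree) :
    ∃ p, Prime p ∧ p ∣ x ∧ 0 < (g (r p)).natDegree := by
  induction x using UniqueFactorizationMonoid.induction_on_prime with
  | h₁ => simp at hx
  | h₂ x hu =>
    have : IsUnit (g (r x)) := (hu.map r).map g
    rw [natDegree_eq_zero_of_isUnit this] at hx
    exact absurd hx (lt_irrefl 0)
  | h₃ a p _ hp ih =>
    by_cases h : 0 < (g (r p)).natDegree
    · exact ⟨p, hp, dvd_mul_right _ _, h⟩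
    · have : 0 < (g (r a)).natDegree := by
        rw [map_mul, map_mul] at hx
        have := natDegree_mul_le (p := g (r p)) (q := g (r a))
        omega
      obtain ⟨q, hq, hqa, hqd⟩ := ih this
      exact ⟨q, hq, hqa.mul_left _, hqd⟩

/-- In a retract of a factorial domain which embeds into `K[X]`, an element of least positive
degree is prime. -/
theorem dvd_or_dvd_of_minimal_natDegree [UniqueFactorizationMonoid R] (hr : ∀ x, r (r x) = r x)
    (hg : ∀ x, r x = x → g x = 0 → x = 0) {f : R} (hf : r f = f) (hd : 0 < (g f).natDegree)
    (hmin : ∀ h, r h = h → 0 < (g h).natDegree → (g f).natDegree ≤ (g h).natDegree)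
    {x y : R} (hx : r x = x) (hy : r y = y) (hxy : f ∣ x * y) : f ∣ x ∨ f ∣ y := by
  obtain ⟨p, hp, ⟨q, hq⟩, hpd⟩ := exists_prime_dvd_of_natDegree_pos r g f (by rwa [hf])
  have hfr : f = r p * r q := by rw [← map_mul, ← hq, hf]
  have hgf : g f ≠ 0 := by
    intro h
    simp [h] at hd
  have hgm : g f = g (r p) * g (r q) := by rw [← map_mul, ← hfr]
  have hne := hgf
  rw [hgm] at hne
  have hdeg : (g f).natDegree = (g (r p)).natDegree + (g (r q)).natDegree := by
    rw [hgm, natDegree_mul (left_ne_zero_of_mul hne) (right_ne_zero_of_mul hne)]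
  have hle := hmin (r p) (hr p) hpd
  -- Minimality leaves no degree for `r q`, so `f` and `r p` agree up to a constant, although `p`
  -- itself need not be fixed by `r`.
  obtain ⟨c, hc⟩ := eq_algebraMap_of_natDegree_eq_zero r g hg (hr q) (by omega)
  have hc0 : c ≠ 0 := by
    rintro rfl
    rw [map_zero] at hc
    simp [hc] at hne
  have hfp : f ∣ r p := by
    refine ⟨algebraMap K R c⁻¹, ?_⟩
    rw [hfr, hc, mul_assoc, ← map_mul, mul_inv_cancel₀ hc0, map_one, mul_one]
  have key : ∀ z, r z = z → p ∣ z → f ∣ z := fun z hz hpz => by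
    have := map_dvd r hpz
    rw [hz] at this
    exact hfp.trans this
  rcases hp.dvd_or_dvd ((Dvd.intro _ hq.symm).trans hxy) with h | h
  · exact Or.inl (key x hx h)
  · exact Or.inr (key y hy h)

/-- Modulo `f`, an integral equation of `h` over `K[f]` acquires constant coefficients and splits;
primality of `f` selects one linear factor. -/
theorem exists_dvd_sub_algebraMap [IsAlgClosed K]
    (hg : ∀ x, r x = x → g x = 0 → x = 0) {f : R} (hf : r f = f) (hd : 0 < (g f).natDegree)
    (hprime : ∀ x y, r x = x → r y = y → f ∣ x * y → f ∣ x ∨ f ∣ y)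
    {h : R} (hh : r h = h) : ∃ c : K, f ∣ h - algebraMap K R c := by
  obtain ⟨F, hFm, hF⟩ := isIntegralElem_aeval_of_natDegree_pos (g f) hd (g h)
  have hF' : eval₂ (aeval f : K[X] →ₐ[K] R).toRingHom h F = 0 := by
    refine hg _ ?_ ?_
    · change r.toRingHom _ = _
      rw [hom_eval₂]
      congr 1
      ext x
      · simp
      · simpa using hf
    · rw [← hF]
      change g.toRingHom _ = _
      rw [hom_eval₂]
      congr 1
      ext x
      · simp
      · simp
  have hdvd : f ∣ aeval h (F.map (evalRingHom 0)) := by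
    rw [← Ideal.mem_span_singleton, ← Ideal.Quotient.eq_zero_iff_mem, aeval_def, eval₂_map,
      hom_eval₂]
    have := congrArg (Ideal.Quotient.mk (Ideal.span {f})) hF'
    rw [hom_eval₂, map_zero] at this
    rw [← this]
    congr 1
    ext x
    · simp
    · simp
  have hsplit := (IsAlgClosed.splits (F.map (evalRingHom (0 : K)))).eq_prod_roots_of_monic
    (hFm.map _)
  rw [hsplit] at hdvd
  have hnu : ¬ f ∣ 1 := fun h => by
    have : IsUnit (g f) := (isUnit_of_dvd_one h).map g
    rw [natDegree_eq_zero_of_isUnit this] at hd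
    exact lt_irrefl 0 hd
  generalize (F.map (evalRingHom (0 : K))).roots = s at hdvd
  induction s using Multiset.induction_on with
  | empty => simp [hnu] at hdvd
  | cons a s ih =>
    rw [Multiset.map_cons, Multiset.prod_cons, map_mul] at hdvd
    rcases hprime _ _ (by simp [hh]) (by rw [← aeval_algHom_apply, hh]) hdvd with h1 | h1
    · exact ⟨a, by simpa using h1⟩
    · exact ih h1

/-- A nontrivial retract of a factorial domain over an algebraically closed field `K` which embeds
into `K[X]` is generated by a single element. -/
theorem exists_generator_of_retract [IsDomain R] [UniqueFactorizationMonoid R] [IsAlgClosed K]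
    (hr : ∀ x, r (r x) = r x)
    (hg : ∀ x, r x = x → g x = 0 → x = 0) (hne : ∃ x, r x = x ∧ 0 < (g x).natDegree) :
    ∃ f, r f = f ∧ 0 < (g f).natDegree ∧ ∀ h, r h = h → ∃ q : K[X], h = aeval f q := by
  classical
  have hex : ∃ d, ∃ x, r x = x ∧ 0 < (g x).natDegree ∧ (g x).natDegree = d :=
    let ⟨x, h1, h2⟩ := hne
    ⟨_, x, h1, h2, rfl⟩
  obtain ⟨f, hf, hd, hfd⟩ := Nat.find_spec hex
  have hmin : ∀ h, r h = h → 0 < (g h).natDegree → (g f).natDegree ≤ (g h).natDegree :=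
    fun h h1 h2 => by
      rw [hfd]
      exact Nat.find_min' hex ⟨h, h1, h2, rfl⟩
  refine ⟨f, hf, hd, fun h hh => ?_⟩
  have hf0 : f ≠ 0 := by
    rintro rfl
    simp at hd
  induction hk : (g h).natDegree using Nat.strong_induction_on generalizing h with
  | _ k ih =>
    by_cases hk0 : k = 0
    · obtain ⟨c, hc⟩ := eq_algebraMap_of_natDegree_eq_zero r g hg hh (hk.trans hk0)
      exact ⟨C c, by simpa using hc⟩
    obtain ⟨c, y, hy⟩ := exists_dvd_sub_algebraMap r g hg hf hd
      (fun x y hx hy hxy => dvd_or_dvd_of_minimal_natDegree r g hr hg hf hd hmin hx hy hxy) hh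
    have hry : r y = y := by
      have := congrArg r hy
      rw [map_mul, hf, map_sub, hh, AlgHom.commutes, hy] at this
      exact (mul_left_cancel₀ hf0 this).symm
    have hdeg : (g y).natDegree < k := by
      have h1 := congrArg (fun z => (g z).natDegree) hy
      simp only [map_sub, map_mul, AlgHom.commutes] at h1
      rw [algebraMap_eq, natDegree_sub_C, hk] at h1
      by_cases hy0 : g y = 0
      · rw [hy0, natDegree_zero]
        omega
      · rw [natDegree_mul (by rintro h0; simp [h0] at hd) hy0] at h1
        omega
    obtain ⟨q, hq⟩ := ih _ hdeg y hry rfl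
    refine ⟨X * q + C c, ?_⟩
    rw [map_add, map_mul, aeval_X, aeval_C, ← hq, ← hy, sub_add_cancel]

end Retract

/-! ### The action on points and the image of an axis -/

section PointAction

open MvPolynomial

variable {P : Type*} [Field P] {n : ℕ}

/-- The polynomial self-map of `Pⁿ` dual to an endomorphism of the polynomial algebra. -/
noncomputable def dualMap (s : EndPoly P n) (a : Fin n → P) : Fin n → P :=
  fun i => eval a (s (X i))

theorem eval_endPoly_apply (s : EndPoly P n) (a : Fin n → P) (p : MvPolynomial (Fin n) P) :
    eval a (s p) = eval (dualMap s a) p := by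
  have : (aeval a : MvPolynomial (Fin n) P →ₐ[P] P).comp s = aeval (dualMap s a) := by
    ext i
    simp [dualMap, aeval_eq_eval]
  simpa [aeval_eq_eval] using DFunLike.congr_fun this p

theorem dualMap_mul (s t : EndPoly P n) (a : Fin n → P) :
    dualMap (s * t) a = dualMap t (dualMap s a) := by
  funext i
  simp only [dualMap, AlgHom.mul_apply, eval_endPoly_apply]

/-- The endomorphism which evaluates polynomials at a point. -/
noncomputable def constEnd (a : Fin n → P) : EndPoly P n :=
  aeval fun i => C (a i)

theorem constEnd_apply (a : Fin n → P) (p : MvPolynomial (Fin n) P) :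
    constEnd a p = C (eval a p) := by
  have : constEnd a = (Algebra.ofId P _).comp (aeval a : MvPolynomial (Fin n) P →ₐ[P] P) := by
    ext i
    simp [constEnd, Algebra.ofId_apply, algebraMap_eq]
  simp [this, Algebra.ofId_apply, algebraMap_eq, aeval_eq_eval]

/-- Being a right zero is a purely multiplicative property, so automorphisms preserve it. -/
theorem mul_constEnd (s : EndPoly P n) (a : Fin n → P) : s * constEnd a = constEnd a := by
  ext1 i
  rw [AlgHom.mul_apply, constEnd_apply, ← algebraMap_eq, AlgHom.commutes]

theorem constEnd_mul (s : EndPoly P n) (a : Fin n → P) :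
    constEnd a * s = constEnd (dualMap s a) := by
  ext1 i
  rw [AlgHom.mul_apply, constEnd_apply, constEnd_apply, eval_endPoly_apply]

theorem constEnd_injective : Function.Injective (constEnd : (Fin n → P) → EndPoly P n) := by
  intro a b h
  funext i
  have := DFunLike.congr_fun h (X i)
  simpa [constEnd_apply] using this

/-- The map on points of `Pⁿ` induced by an automorphism of `End(P[x₁, …, xₙ])`. -/
noncomputable def pointMap (τ : MulAut (EndPoly P n)) (a : Fin n → P) : Fin n → P :=
  dualMap (τ (constEnd a)) 0

theorem apply_constEnd (τ : MulAut (EndPoly P n)) (a : Fin n → P) :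
    τ (constEnd a) = constEnd (pointMap τ a) := by
  rw [pointMap, ← constEnd_mul]
  have := congrArg τ (mul_constEnd (τ.symm (constEnd 0)) a)
  rw [map_mul, MulEquiv.apply_symm_apply] at this
  exact this.symm

theorem pointMap_symm_pointMap (τ : MulAut (EndPoly P n)) (a : Fin n → P) :
    pointMap τ.symm (pointMap τ a) = a := by
  apply constEnd_injective
  rw [← apply_constEnd, ← apply_constEnd, MulEquiv.symm_apply_apply]

theorem pointMap_pointMap_symm (τ : MulAut (EndPoly P n)) (a : Fin n → P) :
    pointMap τ (pointMap τ.symm a) = a :=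
  pointMap_symm_pointMap τ.symm a

theorem dualMap_pointMap (τ : MulAut (EndPoly P n)) (s : EndPoly P n) (a : Fin n → P) :
    dualMap (τ s) (pointMap τ a) = pointMap τ (dualMap s a) := by
  apply constEnd_injective
  rw [← constEnd_mul, ← apply_constEnd, ← map_mul, constEnd_mul, apply_constEnd]

theorem dualMap_aeval (f : Fin n → MvPolynomial (Fin n) P) (a : Fin n → P) :
    dualMap (aeval f : EndPoly P n) a = fun i => eval a (f i) := by
  funext i
  simp [dualMap]

/-- The endomorphism dual to a polynomial function followed by a polynomial curve in `Pⁿ`. -/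
noncomputable def curveEnd (q : Fin n → Polynomial P) (f : MvPolynomial (Fin n) P) : EndPoly P n :=
  aeval fun i => Polynomial.aeval f (q i)

theorem dualMap_curveEnd (q : Fin n → Polynomial P) (f : MvPolynomial (Fin n) P)
    (a : Fin n → P) : dualMap (curveEnd q f) a = fun i => (q i).eval (eval a f) := by
  rw [curveEnd, dualMap_aeval]
  funext i
  have := Polynomial.aeval_algHom_apply (aeval a : MvPolynomial (Fin n) P →ₐ[P] P) f (q i)
  simpa [aeval_eq_eval] using this.symm

/-- The polynomials parametrizing the coordinate axis with index `i`. -/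
noncomputable def axisCurve (i : Fin n) : Fin n → Polynomial P := Pi.single i Polynomial.X

theorem dualMap_curveEnd_axisCurve (i : Fin n) (f : MvPolynomial (Fin n) P) (a : Fin n → P) :
    dualMap (curveEnd (axisCurve i) f) a = Pi.single i (eval a f) := by
  rw [dualMap_curveEnd]
  funext j
  by_cases h : j = i
  · subst h
    simp [axisCurve]
  · simp [axisCurve, h]

theorem exists_polynomial_eval_single (i : Fin n) (f : MvPolynomial (Fin n) P) :
    ∃ q : Polynomial P, ∀ x, q.eval x = eval (Pi.single i x) f := by
  refine ⟨aeval (axisCurve i) f, fun x => ?_⟩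
  have : (Polynomial.aeval x).comp (aeval (axisCurve i) : MvPolynomial (Fin n) P →ₐ[P] _) =
      aeval (Pi.single i x) := by
    ext j
    by_cases h : j = i
    · subst h
      simp [axisCurve]
    · simp [axisCurve, h]
  simpa [aeval_eq_eval, Polynomial.coe_aeval_eq_eval] using DFunLike.congr_fun this f

/-- A nonconstant polynomial function over an algebraically closed field is surjective. -/
theorem polynomial_eval_surjective [IsAlgClosed P] {q : Polynomial P} {x y : P}
    (h : q.eval x ≠ q.eval y) : Function.Surjective fun z => q.eval z := by
  intro c
  have hd : (q - Polynomial.C c).degree ≠ 0 := by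
    intro h0
    rw [Polynomial.eq_C_of_degree_eq_zero h0 |> sub_eq_iff_eq_add.mp] at h
    simp at h
  obtain ⟨z, hz⟩ := IsAlgClosed.exists_root _ hd
  exact ⟨z, by simpa [sub_eq_zero] using hz⟩

/-- The image of a coordinate axis under the induced map on points is a polynomially embedded
affine line. -/
theorem exists_coordinate_of_axis_image [IsAlgClosed P] (τ : MulAut (EndPoly P n)) (i : Fin n) :
    ∃ (f : MvPolynomial (Fin n) P) (q : Fin n → Polynomial P),
      (∀ x j, (q j).eval (eval (pointMap τ (Pi.single i x)) f) = pointMap τ (Pi.single i x) j) ∧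
      Function.Surjective fun x => eval (pointMap τ (Pi.single i x)) f := by
  set φ := pointMap τ with hφ
  set c : P → Fin n → P := fun x => φ (Pi.single i x) with hc
  set r : EndPoly P n := τ (curveEnd (axisCurve i) (X i)) with hr
  have hrφ : ∀ a, dualMap r (φ a) = c (a i) := fun a => by
    rw [hr, dualMap_pointMap, dualMap_curveEnd_axisCurve, eval_X]
  have hrc : ∀ x, dualMap r (c x) = c x := fun x => by
    rw [hrφ, Pi.single_eq_same]
  have hφs : Function.Surjective φ := fun a => ⟨_, pointMap_pointMap_symm τ a⟩
  have hφi : Function.Injective φ := fun a b h => by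
    rw [← pointMap_symm_pointMap τ a, ← pointMap_symm_pointMap τ b]
    exact congrArg _ h
  have hci : Function.Injective c := fun x y h => Pi.single_injective i (hφi h)
  have hrr : ∀ p, r (r p) = r p := fun p => by
    refine MvPolynomial.funext fun a => ?_
    obtain ⟨b, rfl⟩ := hφs a
    rw [eval_endPoly_apply, eval_endPoly_apply, eval_endPoly_apply, hrφ, hrc]
  obtain ⟨j, hj⟩ : ∃ j, c 0 j ≠ c 1 j := by
    by_contra! h
    exact zero_ne_one (hci (funext h))
  set l : Fin n → Polynomial P := fun k =>
    Polynomial.C (c 0 k) + Polynomial.X * Polynomial.C (c 1 k - c 0 k) with hl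
  set w : P → P := fun s => pointMap τ.symm (fun k => (l k).eval s) i with hw
  have hcw : ∀ s, c (w s) = dualMap r (fun k => (l k).eval s) := fun s => by
    rw [hw, ← hrφ, hφ, pointMap_pointMap_symm]
  have hw0 : w 0 = 0 := by
    apply hci
    rw [hcw]
    simp [hl, hrc]
  have hw1 : w 1 = 1 := by
    apply hci
    rw [hcw]
    simp [hl, hrc]
  set g : MvPolynomial (Fin n) P →ₐ[P] Polynomial P := aeval l with hg
  have hge : ∀ s p, r p = p → (g p).eval s = eval (c (w s)) p := fun s p hp => by
    have : (Polynomial.aeval s).comp g = aeval fun k => (l k).eval s := by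
      ext k
      simp [hg, Polynomial.coe_aeval_eq_eval]
    rw [hcw, ← eval_endPoly_apply, hp]
    simpa [aeval_eq_eval, Polynomial.coe_aeval_eq_eval] using DFunLike.congr_fun this p
  have hrX : ∀ x k, eval (c x) (r (X k)) = c x k := fun x k => by
    rw [eval_endPoly_apply, hrc, eval_X]
  have hgX : ∀ s, (g (r (X j))).eval s = c (w s) j := fun s => by
    rw [hge _ _ (hrr _), hrX]
  have hgsurj : Function.Surjective fun s => (g (r (X j))).eval s :=
    polynomial_eval_surjective (x := 0) (y := 1) (by rwa [hgX, hgX, hw0, hw1])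
  -- the parameter of the projected line is itself surjective
  have hws : Function.Surjective w := by
    obtain ⟨h, hh⟩ := exists_polynomial_eval_single i
      (τ.symm (curveEnd (fun k => g (r (X k))) (X j)) (X i))
    have hhx : ∀ x, h.eval x = w (c x j) := fun x => by
      apply hci
      have h1 : curveEnd (axisCurve i) (τ.symm (curveEnd (fun k => g (r (X k))) (X j)) (X i)) =
        τ.symm (curveEnd (fun k => g (r (X k))) (X j)) * curveEnd (axisCurve i) (X i) := by
        ext1 k
        simp only [AlgHom.mul_apply, curveEnd, aeval_X]
        rw [Polynomial.aeval_algHom_apply]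
      have h2 := dualMap_pointMap τ (curveEnd (axisCurve i)
        (τ.symm (curveEnd (fun k => g (r (X k))) (X j)) (X i))) (Pi.single i x)
      rw [dualMap_curveEnd_axisCurve, ← hh, h1, map_mul, MulEquiv.apply_symm_apply, dualMap_mul,
        dualMap_curveEnd, eval_X] at h2
      change c _ = _
      refine h2.symm.trans ?_
      have h3 : (fun k => (g (r (X k))).eval (c x j)) = c (w (c x j)) := by
        funext k
        rw [hge _ _ (hrr _), hrX]
      exact (congrArg (dualMap r) h3).trans (hrc _)
    obtain ⟨s, hs⟩ := hgsurj 0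
    obtain ⟨t, ht⟩ := hgsurj 1
    have hsurj := polynomial_eval_surjective (q := h) (x := w s) (y := w t) (by
      rw [hhx, hhx, ← hgX, ← hgX]
      simp only at hs ht
      rw [hs, ht, hw0, hw1]
      exact zero_ne_one)
    intro y
    obtain ⟨x, hx⟩ := hsurj y
    exact ⟨c x j, (hhx x).symm.trans hx⟩
  -- As `w` is onto, `p` vanishes on the whole image axis, hence `p = r p` vanishes everywhere.
  have hginj : ∀ p, r p = p → g p = 0 → p = 0 := fun p hp h0 => by
    refine MvPolynomial.funext fun a => ?_
    obtain ⟨b, rfl⟩ := hφs a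
    obtain ⟨s, hs⟩ := hws (b i)
    rw [← hp, eval_endPoly_apply, hrφ, ← hs, ← hge s p hp, h0]
    simp
  have hpos : 0 < (g (r (X j))).natDegree := by
    rw [Nat.pos_iff_ne_zero]
    intro h0
    rw [Polynomial.eq_C_of_natDegree_eq_zero h0] at hgsurj
    obtain ⟨s, hs⟩ := hgsurj 0
    obtain ⟨t, ht⟩ := hgsurj 1
    simp only [Polynomial.eval_C] at hs ht
    exact zero_ne_one (hs.symm.trans ht)
  obtain ⟨f, hf, hfd, hfgen⟩ := exists_generator_of_retract r g hrr hginj ⟨_, hrr _, hpos⟩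
  choose q hq using fun k => hfgen (r (X k)) (hrr _)
  refine ⟨f, q, fun x k => ?_, fun y => ?_⟩
  · have := hrX x k
    rw [hq] at this
    refine Eq.trans ?_ this
    have := Polynomial.aeval_algHom_apply (aeval (c x) : MvPolynomial (Fin n) P →ₐ[P] P) f (q k)
    simpa [aeval_eq_eval] using this
  · obtain ⟨s, hs⟩ := IsAlgClosed.exists_root (g f - Polynomial.C y) (by
      rw [Polynomial.degree_sub_C (Polynomial.natDegree_pos_iff_degree_pos.mp hfd)]
      exact (Polynomial.natDegree_pos_iff_degree_pos.mp hfd).ne')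
    refine ⟨w s, ?_⟩
    change eval (c (w s)) f = y
    rw [← hge s f hf]
    simpa [sub_eq_zero] using hs

theorem eval_map_ringEquiv (α : P ≃+* P) (p : MvPolynomial (Fin n) P) (a : Fin n → P) :
    eval (fun i => α (a i)) (map (α : P →+* P) p) = α (eval a p) := by
  have := (eval₂_comp_left (α : P →+* P) (RingHom.id P) a p).symm
  simpa [eval_map, Function.comp_def] using this

/-- The induced map on points is, up to a field automorphism, a polynomial bijection. -/
theorem exists_ringEquiv_polynomial_pointMap [IsAlgClosed P] (τ : MulAut (EndPoly P n))
    (i : Fin n) :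
    ∃ α : P ≃+* P,
      (∀ p : MvPolynomial (Fin n) P, ∃ q : MvPolynomial (Fin n) P,
        ∀ a, eval (pointMap τ a) q = α (eval a p)) ∧
      ∀ p : MvPolynomial (Fin n) P, ∃ q : MvPolynomial (Fin n) P,
        ∀ a, α (eval a q) = eval (pointMap τ a) p := by
  obtain ⟨f, q, hq, hsurj⟩ := exists_coordinate_of_axis_image τ i
  set ψ : P → P := fun x => eval (pointMap τ (Pi.single i x)) f with hψ
  have hinj : Function.Injective ψ := fun x y h => by
    have : pointMap τ (Pi.single i x) = pointMap τ (Pi.single i y) := by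
      funext j
      rw [← hq, ← hq]
      exact congrArg (fun z => (q j).eval z) h
    have := congrArg (pointMap τ.symm) this
    rw [pointMap_symm_pointMap, pointMap_symm_pointMap] at this
    exact Pi.single_injective i this
  have push : ∀ p : MvPolynomial (Fin n) P, ∃ p' : MvPolynomial (Fin n) P,
      ∀ a, eval (pointMap τ a) p' = ψ (eval a p) := fun p => by
    refine ⟨τ (curveEnd (axisCurve i) p) f, fun a => ?_⟩
    rw [eval_endPoly_apply, dualMap_pointMap, dualMap_curveEnd_axisCurve]
  have pull : ∀ p : MvPolynomial (Fin n) P, ∃ p' : MvPolynomial (Fin n) P,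
      ∀ a, ψ (eval a p') = eval (pointMap τ a) p := fun p => by
    -- `curveEnd q p` is dual to a map into the image axis, so its `τ.symm`-conjugate maps into the
    -- axis itself.
    refine ⟨τ.symm (curveEnd q p) (X i), fun a => ?_⟩
    obtain ⟨x, hx⟩ := hsurj (eval (pointMap τ a) p)
    have h1 := dualMap_pointMap τ (τ.symm (curveEnd q p)) a
    rw [MulEquiv.apply_symm_apply, dualMap_curveEnd, ← hx] at h1
    have h2 : pointMap τ (Pi.single i x) = pointMap τ (dualMap (τ.symm (curveEnd q p)) a) := by
      rw [← h1]
      funext j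
      exact (hq x j).symm
    have h3 := congrArg (pointMap τ.symm) h2
    rw [pointMap_symm_pointMap, pointMap_symm_pointMap] at h3
    rw [← hx, eval_endPoly_apply, ← h3, eval_X, Pi.single_eq_same]
  obtain ⟨α, a, b, ha, hα⟩ := exists_ringEquiv_affine_of_conj_polynomial ψ ⟨hinj, hsurj⟩ (by
    intro p
    obtain ⟨p', hp'⟩ := push (Polynomial.aeval (X i) p)
    -- `q` recovers the point of the image axis from its coordinate `ψ x`.
    refine ⟨(aeval q : MvPolynomial (Fin n) P →ₐ[P] _) p', fun x => ?_⟩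
    have h1 : (Polynomial.aeval (ψ x)).comp (aeval q : MvPolynomial (Fin n) P →ₐ[P] _) =
        aeval (pointMap τ (Pi.single i x)) := by
      ext j
      simp [Polynomial.coe_aeval_eq_eval, ← hq x j, hψ]
    have h2 := DFunLike.congr_fun h1 p'
    have h3 := Polynomial.aeval_algHom_apply
      (aeval (Pi.single i x) : MvPolynomial (Fin n) P →ₐ[P] P) (X i) p
    simp only [AlgHom.comp_apply, Polynomial.coe_aeval_eq_eval, aeval_eq_eval, eval_X,
      Pi.single_eq_same] at h2 h3
    rw [h2, hp', h3])
  refine ⟨α, fun p => ?_, fun p => ?_⟩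
  · obtain ⟨p', hp'⟩ := push p
    refine ⟨C a⁻¹ * (p' - C b), fun x => ?_⟩
    rw [map_mul, map_sub, eval_C, eval_C, hp', hα]
    field_simp
    ring
  · obtain ⟨p', hp'⟩ := pull (C a * p + C b)
    refine ⟨p', fun x => mul_left_cancel₀ ha (add_right_cancel (b := b) ?_)⟩
    rw [← hα, hp']
    simp

theorem isSemiInner_of_isAlgClosed [IsAlgClosed P] (τ : MulAut (EndPoly P n)) :
    IsSemiInner τ := by
  rcases Nat.eq_zero_or_pos n with rfl | hn
  -- There is no axis when `n = 0`, but the only endomorphism is the identity.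
  · refine ⟨RingEquiv.refl P, AlgEquiv.refl, fun s => ?_⟩
    have hs : ∀ t : EndPoly P 0, t = AlgHom.id P _ := fun t => by
      ext i
      exact i.elim0
    rw [hs (τ s), hs s]
    funext p
    exact (Equiv.apply_symm_apply _ p).symm
  obtain ⟨α, hpush, hpull⟩ := exists_ringEquiv_polynomial_pointMap τ ⟨0, hn⟩
  choose G hG using fun i => hpush (X i)
  choose Q hQ using fun i => hpull (X i)
  have hφs : Function.Surjective (pointMap τ) := fun a => ⟨_, pointMap_pointMap_symm τ a⟩
  -- Since `G i` takes the value `α (a i)` at `φ a`, untwisting its coefficients makes `η` dual to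
  -- the inverse of `a ↦ α⁻¹(φ a)`.
  let η : EndPoly P n := aeval fun i => map (α.symm : P →+* P) (G i)
  let θ : EndPoly P n := aeval Q
  have hη : ∀ a, dualMap η (fun i => α.symm (pointMap τ a i)) = a := fun a => by
    rw [dualMap_aeval]
    funext i
    rw [eval_map_ringEquiv, hG, eval_X, RingEquiv.symm_apply_apply]
  have hθ : ∀ a, dualMap θ a = fun i => α.symm (pointMap τ a i) := fun a => by
    rw [dualMap_aeval]
    funext i
    rw [RingEquiv.eq_symm_apply, hQ, eval_X]
  have hηs : ∀ a : Fin n → P, ∃ b, a = fun i => α.symm (pointMap τ b i) := fun a => by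
    obtain ⟨b, hb⟩ := hφs fun i => α (a i)
    exact ⟨b, by simp [hb]⟩
  have hηθ : ∀ p, η (θ p) = p := fun p => MvPolynomial.funext fun a => by
    obtain ⟨b, rfl⟩ := hηs a
    rw [eval_endPoly_apply, eval_endPoly_apply, hη, hθ]
  have hθη : ∀ p, θ (η p) = p := fun p => MvPolynomial.funext fun a => by
    rw [eval_endPoly_apply, eval_endPoly_apply, hθ, hη]
  let e : MvPolynomial (Fin n) P ≃ₐ[P] MvPolynomial (Fin n) P :=
    AlgEquiv.ofAlgHom η θ (AlgHom.ext hηθ) (AlgHom.ext hθη)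
  have hμ : ∀ p a, eval (pointMap τ a) ((coeffExtension n α * e.toEquiv) p) = α (eval a p) :=
    fun p a => by
      change eval (pointMap τ a) (map (α : P →+* P) (η p)) = _
      have := eval_map_ringEquiv α (η p) fun i => α.symm (pointMap τ a i)
      simp only [RingEquiv.apply_symm_apply] at this
      rw [this, eval_endPoly_apply, hη]
  refine ⟨α, e, fun s => ?_⟩
  rw [← Function.comp_assoc, Equiv.eq_comp_symm]
  funext p
  refine MvPolynomial.funext fun a => ?_
  obtain ⟨b, rfl⟩ := hφs a
  rw [Function.comp_apply, Function.comp_apply, hμ, eval_endPoly_apply, eval_endPoly_apply,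
    dualMap_pointMap, hμ]

end PointAction

theorem theorem3 {P : Type*} [Field P] [IsAlgClosed P] (n : ℕ) :
    Subgroup.closure {τ : MulAut (EndPoly P n) | IsSemiInner τ} = ⊤ ∧
      ∀ τ : MulAut (EndPoly P n), IsSemiInner τ := by
  refine ⟨eq_top_iff.mpr fun τ _ => Subgroup.subset_closure ?_, isSemiInner_of_isAlgClosed⟩
  exact isSemiInner_of_isAlgClosed τ
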